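/- Let $p$ be a prime, let $G$ be a finite $p$-group, and let $\mathcal{C}$ be a $*$-covering of $G$, that is, a set of subgroups of $G$ whose union is $G$, each of which is either a maximal cyclic subgroup of $G$ (a cyclic subgroup not properly contained in any cyclic subgroup of $G$) or an elementary abelian $p$-group of order $p^2$. Let \[R_{\mathcal{C}}(G)=\{f\colon G\to G \mid f|_C\in\operatorname{End}(C)\text{ for each } C\in\mathcal{C}\},\] which is a ring under pointwise addition of functions (using the operation of $G$) and composition. (1) If $R_{\mathcal{C}}(G)$ is a simple ring (that is, a nonzero ring whose only two-sided ideals are $0$ and itself), then $R_{\mathcal{C}}(G)$ is isomorphic, as a ring, to $\mathbb{Z}_p=\mathbb{Z}/p\mathbb{Z}$ or to the ring $M_2(\mathbb{Z}_p)$ of $2\times 2$ matrices over $\mathbb{Z}_p$. (2) If $R_{\mathcal{C}}(G)\cong M_2(\mathbb{Z}_p)$ as rings, then $G\cong\mathbb{Z}_p\times\mathbb{Z}_p$ and $\mathcal{C}=\{G\}$. -/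

import Mathlib

/-- A cover of the group `G` by abelian subgroups (its cells). -/
structure AbelianCovering (G : Type*) [Group G] where
  /-- The collection of subgroups. -/
  cells : Set (Subgroup G)
  /-- The union of the cells is `G`. -/
  iUnion_cells : ⋃ C ∈ cells, (C : Set G) = Set.univ
  /-- Each cell is abelian. -/
  mul_comm_of_mem : ∀ C ∈ cells, ∀ x ∈ C, ∀ y ∈ C, x * y = y * x

/-- `C` is a maximal cyclic subgroup: it is cyclic and no cyclic subgroup of `G` properly
contains it. -/
def IsMaximalCyclic {G : Type*} [Group G] (C : Subgroup G) : Prop :=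
  Maximal (fun H : Subgroup G => IsCyclic H) C

/-- `C` is an elementary abelian `p`-group of order `p ^ 2`. -/
def IsElementaryAbelianOfOrderSq {G : Type*} [Group G] (p : ℕ) (C : Subgroup G) : Prop :=
  (∀ x ∈ C, ∀ y ∈ C, x * y = y * x) ∧ (∀ x ∈ C, x ^ p = 1) ∧ Nat.card C = p ^ 2

/-- The function `f : G → G` restricts to an endomorphism of the subgroup `C`. -/
def RestrictsToEnd {G : Type*} [Group G] (C : Subgroup G) (f : G → G) : Prop :=
  (∀ x ∈ C, f x ∈ C) ∧ ∀ x ∈ C, ∀ y ∈ C, f (x * y) = f x * f y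

namespace AbelianCovering

variable {G : Type*} [Group G]

/-- Every cell is a maximal cyclic subgroup of `G` or is elementary abelian of order `p ^ 2`. -/
def IsStarCovering (p : ℕ) (𝒞 : AbelianCovering G) : Prop :=
  ∀ C ∈ 𝒞.cells, IsMaximalCyclic C ∨ IsElementaryAbelianOfOrderSq p C

theorem exists_mem_cell (𝒞 : AbelianCovering G) (x : G) : ∃ C ∈ 𝒞.cells, x ∈ C := by
  have h : x ∈ ⋃ C ∈ 𝒞.cells, (C : Set G) := by rw [𝒞.iUnion_cells]; trivial
  simpa using h

/-- The functions `G → G` that restrict to an endomorphism of every cell. -/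
structure CoverRing (𝒞 : AbelianCovering G) where
  /-- The underlying function. -/
  toFun : G → G
  /-- The function restricts to an endomorphism of each cell. -/
  restricts : ∀ C ∈ 𝒞.cells, RestrictsToEnd C toFun

namespace CoverRing

variable {𝒞 : AbelianCovering G}

@[ext]
theorem ext {f g : 𝒞.CoverRing} (h : ∀ x, f.toFun x = g.toFun x) : f = g := by
  cases f; cases g; congr; exact funext h

/-- The zero function, which sends everything to the identity element of `G`. -/
instance : Zero 𝒞.CoverRing where
  zero := ⟨fun _ => 1, fun C _ => ⟨fun _ _ => C.one_mem, fun _ _ _ _ => (mul_one 1).symm⟩⟩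

/-- The identity function. -/
instance : One 𝒞.CoverRing where
  one := ⟨fun x => x, fun _ _ => ⟨fun _ h => h, fun _ _ _ _ => rfl⟩⟩

/-- The sum of two functions is taken pointwise, with the operation of `G`. -/
instance : Add 𝒞.CoverRing where
  add f g := ⟨fun x => f.toFun x * g.toFun x, fun C hC =>
    ⟨fun x hx => C.mul_mem ((f.restricts C hC).1 x hx) ((g.restricts C hC).1 x hx), fun x hx y hy => by
      beta_reduce
      have h := 𝒞.mul_comm_of_mem C hC _ ((f.restricts C hC).1 y hy) _ ((g.restricts C hC).1 x hx)
      rw [(f.restricts C hC).2 x hx y hy, (g.restricts C hC).2 x hx y hy, mul_assoc, ← mul_assoc (f.toFun y), h]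
      simp only [mul_assoc]⟩⟩

/-- The negative of a function is the pointwise inverse. -/
instance : Neg 𝒞.CoverRing where
  neg f := ⟨fun x => (f.toFun x)⁻¹, fun C hC =>
    ⟨fun x hx => C.inv_mem ((f.restricts C hC).1 x hx), fun x hx y hy => by
      beta_reduce
      have h := 𝒞.mul_comm_of_mem C hC _ ((f.restricts C hC).1 x hx) _ ((f.restricts C hC).1 y hy)
      rw [(f.restricts C hC).2 x hx y hy, h, mul_inv_rev]⟩⟩

/-- The product of two functions is their composition. -/
instance : Mul 𝒞.CoverRing where
  mul f g := ⟨fun x => f.toFun (g.toFun x), fun C hC =>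
    ⟨fun x hx => (f.restricts C hC).1 _ ((g.restricts C hC).1 x hx), fun x hx y hy => by
      beta_reduce
      rw [(g.restricts C hC).2 x hx y hy,
        (f.restricts C hC).2 _ ((g.restricts C hC).1 x hx) _ ((g.restricts C hC).1 y hy)]⟩⟩

theorem zero_apply (x : G) : (0 : 𝒞.CoverRing).toFun x = 1 := rfl

theorem one_apply (x : G) : (1 : 𝒞.CoverRing).toFun x = x := rfl

theorem add_apply (f g : 𝒞.CoverRing) (x : G) : (f + g).toFun x = f.toFun x * g.toFun x := rfl

theorem neg_apply (f : 𝒞.CoverRing) (x : G) : (-f).toFun x = (f.toFun x)⁻¹ := rfl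

theorem mul_apply (f g : 𝒞.CoverRing) (x : G) : (f * g).toFun x = f.toFun (g.toFun x) := rfl

theorem map_one (f : 𝒞.CoverRing) : f.toFun 1 = 1 := by
  obtain ⟨C, hC, h1⟩ := 𝒞.exists_mem_cell 1
  have h := (f.restricts C hC).2 1 h1 1 h1
  rw [mul_one] at h
  exact left_eq_mul.mp h

/-- Pointwise addition and composition make the functions that are endomorphisms on each cell
into a ring. -/
instance : Ring 𝒞.CoverRing where
  add_assoc f g h := ext fun x => mul_assoc _ _ _
  zero_add f := ext fun x => one_mul _
  add_zero f := ext fun x => mul_one _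
  nsmul := nsmulRec
  zsmul := zsmulRec
  neg_add_cancel f := ext fun x => inv_mul_cancel _
  add_comm f g := ext fun x => by
    obtain ⟨C, hC, hx⟩ := 𝒞.exists_mem_cell x
    exact 𝒞.mul_comm_of_mem C hC _ ((f.restricts C hC).1 x hx) _ ((g.restricts C hC).1 x hx)
  mul_assoc f g h := ext fun x => rfl
  one_mul f := ext fun x => rfl
  mul_one f := ext fun x => rfl
  zero_mul f := ext fun x => rfl
  mul_zero f := ext fun x => map_one f
  left_distrib f g h := ext fun x => by
    obtain ⟨C, hC, hx⟩ := 𝒞.exists_mem_cell x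
    exact (f.restricts C hC).2 _ ((g.restricts C hC).1 x hx) _ ((h.restricts C hC).1 x hx)
  right_distrib f g h := ext fun x => rfl

end CoverRing

end AbelianCovering

/-! If `S` is stable under every element of the ring, the functions trivial on `S` form a two-sided
ideal. When the ring is simple and `S` has a nontrivial element, this ideal is zero. So if `x` has
order `p` and the ring maps `⟨x⟩` to itself, evaluation at `x` is injective and the ring is `ℤ/p`. A
cyclic cell gives such an `x` (its unique subgroup of order `p`), and so do two distinct cells of
order `p ^ 2` that meet nontrivially. Otherwise all cells are elementary abelian and meet pairwise
trivially. The projection onto one cell is then trivial on any other, so there is only one cell,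
namely `G`, and the ring is `End (ℤ/p)²`. Part (2) uses the same dichotomy, as `M₂(ℤ/p)` is simple
and noncommutative. -/

namespace AbelianCovering

namespace CoverRing

variable {G : Type*} [Group G] {𝒞 : AbelianCovering G}

/-- The restriction of an element of the ring to a cell, as a monoid homomorphism. -/
def restrict (f : 𝒞.CoverRing) {C : Subgroup G} (hC : C ∈ 𝒞.cells) : C →* G :=
  MonoidHom.mk' (fun x => f.toFun x) fun x y => (f.restricts C hC).2 x x.2 y y.2

theorem map_zpow (f : 𝒞.CoverRing) (x : G) (k : ℤ) : f.toFun (x ^ k) = f.toFun x ^ k := by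
  obtain ⟨C, hC, hx⟩ := 𝒞.exists_mem_cell x
  exact _root_.map_zpow (f.restrict hC) ⟨x, hx⟩ k

theorem map_pow (f : 𝒞.CoverRing) (x : G) (n : ℕ) : f.toFun (x ^ n) = f.toFun x ^ n := by
  simpa using f.map_zpow x n

theorem natCast_apply (n : ℕ) (x : G) : (n : 𝒞.CoverRing).toFun x = x ^ n := by
  induction n with
  | zero => simp [zero_apply]
  | succ n ih => rw [Nat.cast_succ, add_apply, ih, one_apply, pow_succ]

/-- The elements of the ring that vanish on a set stable under all elements of the ring. -/
def annihilator (S : Set G) (hS : ∀ f : 𝒞.CoverRing, ∀ y ∈ S, f.toFun y ∈ S) :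
    TwoSidedIdeal 𝒞.CoverRing :=
  TwoSidedIdeal.mk' {f | ∀ y ∈ S, f.toFun y = 1}
    (fun _ _ => rfl)
    (fun {f g} hf hg y hy => by rw [add_apply, hf y hy, hg y hy, one_mul])
    (fun {f} hf y hy => by rw [neg_apply, hf y hy, inv_one])
    (fun {f g} hg y hy => by rw [mul_apply, hg y hy, map_one])
    (fun {f g} hf y hy => by rw [mul_apply]; exact hf _ (hS g y hy))

theorem eq_zero_of_vanishes_on [IsSimpleRing 𝒞.CoverRing] {S : Set G}
    (hS : ∀ f : 𝒞.CoverRing, ∀ y ∈ S, f.toFun y ∈ S) {x : G} (hx : x ∈ S) (hx1 : x ≠ 1)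
    {f : 𝒞.CoverRing} (hf : ∀ y ∈ S, f.toFun y = 1) : f = 0 := by
  have mem_iff (g : 𝒞.CoverRing) : g ∈ annihilator S hS ↔ ∀ y ∈ S, g.toFun y = 1 :=
    TwoSidedIdeal.mem_mk' ..
  rcases eq_bot_or_eq_top (annihilator S hS) with h | h
  · have := (mem_iff f).2 hf
    rwa [h, TwoSidedIdeal.mem_bot] at this
  · have h1 : (1 : 𝒞.CoverRing) ∈ annihilator S hS := h ▸ TwoSidedIdeal.mem_top _
    exact absurd ((mem_iff 1).1 h1 x hx) hx1

theorem exists_ne_one [Nontrivial 𝒞.CoverRing] : ∃ x : G, x ≠ 1 := by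
  by_contra! h
  exact zero_ne_one (α := 𝒞.CoverRing) (ext fun x => (h _).trans (h _).symm)

/-- A simple ring whose elements all act as powers on some element of order `p` is `ℤ/p`. -/
theorem nonempty_ringEquiv_zmod [IsSimpleRing 𝒞.CoverRing] {p : ℕ} [Fact p.Prime] {x : G}
    (hx1 : x ≠ 1) (hxp : x ^ p = 1)
    (hx : ∀ f : 𝒞.CoverRing, f.toFun x ∈ Subgroup.zpowers x) :
    Nonempty (𝒞.CoverRing ≃+* ZMod p) := by
  -- Injectivity of evaluation at `x`, from the vanishing ideal of `⟨x⟩`.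
  have key (f : 𝒞.CoverRing) (hf : f.toFun x = 1) : f = 0 := by
    refine eq_zero_of_vanishes_on (S := Subgroup.zpowers x) ?_
      (Subgroup.mem_zpowers x) hx1 ?_
    · rintro g _ ⟨k, rfl⟩
      change g.toFun (x ^ k) ∈ Subgroup.zpowers x
      exact g.map_zpow x k ▸ Subgroup.zpow_mem _ (hx g) k
    · rintro _ ⟨k, rfl⟩
      simp only [map_zpow, hf, one_zpow]
  have hp : (p : 𝒞.CoverRing) = 0 := key _ (by rw [natCast_apply, hxp])
  have : CharP 𝒞.CoverRing p := (CharP.charP_iff_prime_eq_zero Fact.out).2 hp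
  refine ⟨(RingEquiv.ofBijective (ZMod.castHom dvd_rfl 𝒞.CoverRing)
    ⟨RingHom.injective _, fun f => ?_⟩).symm⟩
  have hfin : IsOfFinOrder x := 
    isOfFinOrder_iff_pow_eq_one.2 ⟨p, (Fact.out : p.Prime).pos, hxp⟩
  obtain ⟨k, hk⟩ := hfin.mem_powers_iff_mem_zpowers.2 (hx f)
  refine ⟨k, ?_⟩
  -- As `f` sends `x` to `x ^ k`, the difference `k - f` is trivial at `x`.
  rw [map_natCast, ← sub_eq_zero, sub_eq_add_neg]
  refine key _ ?_
  rw [add_apply, natCast_apply, neg_apply, ← hk, mul_inv_cancel]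

end CoverRing

/-- In a cyclic group `a ^ p = 1` has at most `p` solutions, and the powers of `x` already supply
`p`. -/
theorem mem_zpowers_of_isCyclic {G : Type*} [Group G] [Finite G] {p : ℕ} [Fact p.Prime]
    {C : Subgroup G} (hC : IsCyclic C) {x y : G} (hx : x ∈ C) (hy : y ∈ C) (hx1 : x ≠ 1)
    (hxp : x ^ p = 1) (hyp : y ^ p = 1) : y ∈ Subgroup.zpowers x := by
  classical
  have := Fintype.ofFinite C
  let T : Finset C := {a | a ^ p = 1}
  let f : ℕ → C := fun i => ⟨x, hx⟩ ^ i
  have hord : orderOf (⟨x, hx⟩ : C) = p :=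
    orderOf_eq_prime (Subtype.ext hxp) fun h => hx1 (congrArg Subtype.val h)
  have hsub : (Finset.range p).image f ⊆ T := by
    intro a ha
    obtain ⟨i, -, rfl⟩ := Finset.mem_image.1 ha
    simp only [T, f, Finset.mem_filter_univ]
    rw [pow_right_comm, ← hord, pow_orderOf_eq_one, one_pow]
  have hcard : ((Finset.range p).image f).card = p := by
    rw [Finset.card_image_of_injOn, Finset.card_range]
    intro i hi j hj hij
    exact pow_injOn_Iio_orderOf (by simpa [hord] using hi) (by simpa [hord] using hj) hij
  have heq := Finset.eq_of_subset_of_card_le hsub <|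
    (IsCyclic.card_pow_eq_one_le (Fact.out : p.Prime).pos).trans_eq hcard.symm
  have hyT : (⟨y, hy⟩ : C) ∈ T := by
    rw [Finset.mem_filter_univ]; exact Subtype.ext hyp
  rw [← heq] at hyT
  obtain ⟨i, -, hi⟩ := Finset.mem_image.1 hyT
  exact ⟨i, by simpa [f] using congrArg Subtype.val hi⟩

/-- The intersection is proper in both subgroups, so its order is at most `p` and `x` generates it.
-/
theorem mem_zpowers_of_card_sq {G : Type*} [Group G] [Finite G] {p : ℕ} [Fact p.Prime]
    {C D : Subgroup G} (hC : Nat.card C = p ^ 2) (hD : Nat.card D = p ^ 2) (hCD : C ≠ D) {x y : G}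
    (hx : x ∈ C ⊓ D) (hy : y ∈ C ⊓ D) (hx1 : x ≠ 1) (hxp : x ^ p = 1) :
    y ∈ Subgroup.zpowers x := by
  have hpr : p.Prime := Fact.out
  have hcard : Nat.card (Subgroup.zpowers x) = p := by
    rw [Nat.card_zpowers]; exact orderOf_eq_prime hxp hx1
  have hle : Subgroup.zpowers x ≤ C ⊓ D := Subgroup.zpowers_le.2 hx
  obtain ⟨k, hk, hk'⟩ := (Nat.dvd_prime_pow hpr).1
    (hC ▸ Subgroup.card_dvd_of_le (inf_le_left : C ⊓ D ≤ C))
  have hk2 : k ≠ 2 := by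
    rintro rfl
    have h1 : C ⊓ D = C := Subgroup.eq_of_le_of_card_ge inf_le_left (by rw [hk', hC])
    have h2 : C ⊓ D = D := Subgroup.eq_of_le_of_card_ge inf_le_right (by rw [hk', hD])
    exact hCD (h1.symm.trans h2)
  have hk1 : p ^ k ≤ p ^ 1 := Nat.pow_le_pow_right hpr.pos (by omega)
  have : Subgroup.zpowers x = C ⊓ D :=
    Subgroup.eq_of_le_of_card_ge hle (by rw [hk', hcard]; simpa using hk1)
  exact this ▸ hy

variable {G : Type*} [Group G] {𝒞 : AbelianCovering G}

/-- If a cell meets all other cells trivially, the function that is the identity on this cell and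
trivial elsewhere belongs to the ring. -/
noncomputable def CoverRing.projection {C : Subgroup G}
    (h : ∀ D ∈ 𝒞.cells, D ≠ C → D ⊓ C = ⊥) : 𝒞.CoverRing := by
  classical
  exact
  { toFun := fun x => if x ∈ C then x else 1
    restricts := fun D hD => by
      by_cases hDC : D = C
      · subst hDC
        refine ⟨fun x hx => by simp [hx], fun x hx y hy => ?_⟩
        simp [hx, hy, D.mul_mem hx hy]
      · have key : ∀ x ∈ D, (if x ∈ C then x else 1) = 1 := fun x hx => by
          split_ifs with hxC
          · exact Subgroup.mem_bot.1 (h D hD hDC ▸ Subgroup.mem_inf.2 ⟨hx, hxC⟩)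
          · rfl
        refine ⟨fun x hx => by beta_reduce; rw [key x hx]; exact D.one_mem, fun x hx y hy => ?_⟩
        beta_reduce
        rw [key x hx, key y hy, key _ (D.mul_mem hx hy), one_mul] }

theorem ringEquiv_zmod_or_cells_eq_top [Finite G] {p : ℕ} [Fact p.Prime] (hG : IsPGroup p G)
    (h𝒞 : 𝒞.IsStarCovering p) [IsSimpleRing 𝒞.CoverRing] :
    Nonempty (𝒞.CoverRing ≃+* ZMod p) ∨
      𝒞.cells = {(⊤ : Subgroup G)} ∧ IsElementaryAbelianOfOrderSq p (⊤ : Subgroup G) := by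
  have hpr : p.Prime := Fact.out
  by_cases hcyc : ∃ C ∈ 𝒞.cells, IsMaximalCyclic C
  · left
    obtain ⟨C, hC, hmax⟩ := hcyc
    -- A trivial maximal cyclic subgroup would force `G` to be trivial and the ring to be zero.
    have hne : Nontrivial C := by
      rw [Subgroup.nontrivial_iff_ne_bot]
      rintro rfl
      obtain ⟨g, hg⟩ := CoverRing.exists_ne_one (𝒞 := 𝒞)
      have : Subgroup.zpowers g ≤ ⊥ :=
        hmax.2 (y := Subgroup.zpowers g) inferInstance bot_le
      exact hg (Subgroup.mem_bot.1 (this (Subgroup.mem_zpowers g)))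
    obtain ⟨n, hn, hcard⟩ := (hG.to_subgroup C).nontrivial_iff_card.1 hne
    obtain ⟨x, hx⟩ := exists_prime_orderOf_dvd_card' (G := C) p (hcard ▸ dvd_pow_self p hn.ne')
    have hxp : (x : G) ^ p = 1 := by
      rw [← hx, ← Subgroup.orderOf_coe, pow_orderOf_eq_one]
    have hx1 : (x : G) ≠ 1 := fun h => by
      rw [← Subgroup.orderOf_coe, h, orderOf_one] at hx
      exact hpr.one_lt.ne hx
    refine CoverRing.nonempty_ringEquiv_zmod hx1 hxp fun f => ?_
    exact mem_zpowers_of_isCyclic hmax.1 x.2 ((f.restricts C hC).1 x x.2) hx1 hxp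
      (by rw [← CoverRing.map_pow, hxp, CoverRing.map_one])
  have hel : ∀ C ∈ 𝒞.cells, IsElementaryAbelianOfOrderSq p C := fun C hC =>
    (h𝒞 C hC).resolve_left fun h => hcyc ⟨C, hC, h⟩
  by_cases hint : ∃ C ∈ 𝒞.cells, ∃ D ∈ 𝒞.cells, C ≠ D ∧ C ⊓ D ≠ ⊥
  · left
    obtain ⟨C, hC, D, hD, hCD, hbot⟩ := hint
    obtain ⟨x, hx, hx1⟩ := (C ⊓ D).bot_or_exists_ne_one.resolve_left hbot
    have hxp := (hel C hC).2.1 x hx.1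
    exact CoverRing.nonempty_ringEquiv_zmod hx1 hxp fun f =>
      mem_zpowers_of_card_sq (hel C hC).2.2 (hel D hD).2.2 hCD hx
        ⟨(f.restricts C hC).1 x hx.1, (f.restricts D hD).1 x hx.2⟩ hx1 hxp
  · right
    push Not at hint
    have hnt (C) (hC : C ∈ 𝒞.cells) : ∃ x ∈ C, x ≠ 1 := by
      have : C ≠ ⊥ := by
        rintro rfl
        have := (hel _ hC).2.2
        rw [Subgroup.card_bot] at this
        exact (Nat.one_lt_pow two_ne_zero hpr.one_lt).ne this
      exact C.bot_or_exists_ne_one.resolve_left this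
    obtain ⟨C, hC, -⟩ := 𝒞.exists_mem_cell 1
    have huniq : ∀ D ∈ 𝒞.cells, D = C := by
      intro D hD
      by_contra hDC
      have hproj : ∀ E ∈ 𝒞.cells, E ≠ C → E ⊓ C = ⊥ := fun E hE hEC => hint E hE C hC hEC
      obtain ⟨x, hxD, hx1⟩ := hnt D hD
      obtain ⟨y, hyC, hy1⟩ := hnt C hC
      -- The projection onto `C` is trivial on `D`, hence zero by simplicity, yet it fixes `y ≠ 1`.
      have h0 : CoverRing.projection hproj = 0 := by
        refine CoverRing.eq_zero_of_vanishes_on (S := D)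
          (fun f z hz => (f.restricts D hD).1 z hz) hxD hx1 fun z hz => ?_
        simp only [CoverRing.projection, ite_eq_right_iff]
        exact fun hzC => Subgroup.mem_bot.1 (hproj D hD hDC ▸ Subgroup.mem_inf.2 ⟨hz, hzC⟩)
      have hy := congrArg (fun f => f.toFun y) h0
      simp only [CoverRing.projection, hyC, if_true] at hy
      exact hy1 hy
    have hCtop : C = ⊤ := by
      rw [eq_top_iff]
      intro x _
      obtain ⟨D, hD, hx⟩ := 𝒞.exists_mem_cell x
      exact huniq D hD ▸ hx
    subst hCtop
    exact ⟨Set.eq_singleton_iff_unique_mem.2 ⟨hC, huniq⟩, hel _ hC⟩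

theorem nonempty_addEquiv_pi_zmod {V : Type*} [AddCommGroup V] [Finite V] {p : ℕ}
    [Fact p.Prime] (hp : ∀ v : V, p • v = 0) (hcard : Nat.card V = p ^ 2) :
    Nonempty (V ≃+ (Fin 2 → ZMod p)) := by
  have : Module (ZMod p) V := AddCommGroup.zmodModule hp
  have hfr : Module.finrank (ZMod p) V = 2 := by
    have := FiniteField.pow_finrank_eq_natCard p V
    exact Nat.pow_right_injective (Fact.out : p.Prime).two_le (this.trans hcard)
  have b : Module.Basis (Fin 2) (ZMod p) V := Module.finBasisOfFinrankEq _ _ hfr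
  exact ⟨b.equivFun.toAddEquiv⟩

theorem nonempty_mulEquiv_pi_zmod [Finite G] {p : ℕ} [Fact p.Prime]
    (h : IsElementaryAbelianOfOrderSq p (⊤ : Subgroup G)) :
    Nonempty (G ≃* Multiplicative (Fin 2 → ZMod p)) := by
  let _ : CommGroup G :=
    { ‹Group G› with mul_comm := fun x y => h.1 x trivial y trivial }
  obtain ⟨e⟩ := nonempty_addEquiv_pi_zmod (V := Additive G) (p := p)
    (fun x => congrArg Additive.ofMul (h.2.1 x.toMul trivial))
    (by rw [← h.2.2, Subgroup.card_top]; rfl)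
  exact ⟨AddEquiv.toMultiplicativeRight e⟩

/-- If `G` is the only cell and is an elementary abelian `p`-group, the ring consists of the linear
endomorphisms. -/
def CoverRing.equivEnd {p : ℕ} {V : Type*} [AddCommGroup V] [Module (ZMod p) V]
    (e : G ≃* Multiplicative V) (h : 𝒞.cells = {(⊤ : Subgroup G)}) :
    𝒞.CoverRing ≃+* Module.End (ZMod p) V where
  toFun f := AddMonoidHom.toZModLinearMap p <|
    AddMonoidHom.mk' (fun v => (e (f.toFun (e.symm (.ofAdd v)))).toAdd) fun v w => by
      rw [ofAdd_add, map_mul, (f.restricts ⊤ (h ▸ rfl)).2 _ trivial _ trivial, map_mul, toAdd_mul]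
  invFun g :=
    { toFun := fun x => e.symm (.ofAdd (g (e x).toAdd))
      restricts := fun C hC => by
        obtain rfl : C = ⊤ := by rwa [h] at hC
        exact ⟨fun _ _ => trivial, fun x _ y _ => by simp⟩ }
  left_inv f := CoverRing.ext fun x => by simp
  right_inv g := by ext; simp
  map_mul' f g := by ext; simp [CoverRing.mul_apply]
  map_add' f g := by ext; simp [CoverRing.add_apply]

end AbelianCovering

theorem mainTheorem3 (p : ℕ) [Fact p.Prime] (G : Type*) [Group G] [Finite G] (hG : IsPGroup p G)
    (𝒞 : AbelianCovering G) (h𝒞 : 𝒞.IsStarCovering p) :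
    (IsSimpleRing 𝒞.CoverRing →
      Nonempty (𝒞.CoverRing ≃+* ZMod p) ∨
        Nonempty (𝒞.CoverRing ≃+* Matrix (Fin 2) (Fin 2) (ZMod p))) ∧
    (Nonempty (𝒞.CoverRing ≃+* Matrix (Fin 2) (Fin 2) (ZMod p)) →
      Nonempty (G ≃* Multiplicative (ZMod p × ZMod p)) ∧ 𝒞.cells = {(⊤ : Subgroup G)}) := by
  constructor
  · intro _
    refine (AbelianCovering.ringEquiv_zmod_or_cells_eq_top hG h𝒞).imp_right fun ⟨hcells, hel⟩ => ?_
    obtain ⟨e⟩ := AbelianCovering.nonempty_mulEquiv_pi_zmod hel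
    exact ⟨(AbelianCovering.CoverRing.equivEnd e hcells).trans
      (LinearMap.toMatrixAlgEquiv' (R := ZMod p) (n := Fin 2)).toRingEquiv⟩
  · rintro ⟨φ⟩
    have : IsSimpleRing 𝒞.CoverRing := IsSimpleRing.of_ringEquiv φ.symm inferInstance
    rcases AbelianCovering.ringEquiv_zmod_or_cells_eq_top hG h𝒞 with ⟨⟨ψ⟩⟩ | ⟨hcells, hel⟩
    · have hcomm (A B : Matrix (Fin 2) (Fin 2) (ZMod p)) : A * B = B * A :=
        (φ.symm.trans ψ).injective (by rw [map_mul, map_mul, mul_comm])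
      -- The two products are `E₀₀` and `E₁₁`, which differ at entry `(0, 0)`.
      simpa using congrFun (congrFun (hcomm (.single 0 1 1) (.single 1 0 1)) 0) 0
    · obtain ⟨e⟩ := AbelianCovering.nonempty_mulEquiv_pi_zmod hel
      exact ⟨⟨e.trans (AddEquiv.toMultiplicative
        (LinearEquiv.finTwoArrow (ZMod p) (ZMod p)).toAddEquiv)⟩, hcells⟩
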